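/- Let $\mathbb K$ be a real-closed ordered field with order $\preceq$, let $V$ be a finite set with $N=\#V\ge 2$ elements, and let $b:V\times V\to\mathbb K$ satisfy $b(x,y)\succeq 0$, $b(x,y)=b(y,x)$ and $b(x,x)=0$ for all $x,y\in V$. Put $b(x)=\sum_{y\in V}b(x,y)$ and suppose that $b(x)\neq 0$ for every $x\in V$ (no isolated vertices). For $V_1,V_2\subset V$ put $b(V_1)=\sum_{x\in V_1}b(x)$ and $b(V_1,V_2)=\sum_{x\in V_1,\,y\in V_2}b(x,y)$, and let $$\overline h=\max_{\substack{\emptyset\ne V_1\subset V,\ \emptyset\ne V_2\subset V,\\ V_1\cap V_2=\emptyset}}\frac{2b(V_1,V_2)}{b(V_1)+b(V_2)}$$ be the dual Cheeger constant. Let $\mathcal L$ be the normalized Laplacian on the functions $f:V\to\mathbb K$, $$\mathcal Lf(x)=\sum_{y\in V}(f(x)-f(y))\frac{b(x,y)}{b(x)}.$$ Then $\mathcal L$ has a largest eigenvalue $\lambda_{N-1}$ in $\mathbb K$, the element $1-(1-\overline h)^2$ has a nonnegative square root in $\mathbb K$, and $$2\overline h\preceq\lambda_{N-1}\preceq 1+\sqrt{1-(1-\overline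 h)^2}.$$ -/

import Mathlib

/-- A graph over an ordered field `K` with vertex set `V`: symmetric nonnegative edge weights `b`,
vanishing on the diagonal (no loops). -/
structure OFGraph (V K : Type*) [Zero K] [LE K] where
  b : V → V → K
  nonneg : ∀ x y, 0 ≤ b x y
  symm : ∀ x y, b x y = b y x
  loopless : ∀ x, b x x = 0

namespace OFGraph

variable {V K : Type*} [Fintype V] [Field K] [LinearOrder K]

/-- The weight `b(x) = ∑_y b(x,y)` of a vertex. -/
def deg (G : OFGraph V K) (x : V) : K := ∑ y, G.b x y

/-- The weight `b(V₁) = ∑_{x ∈ V₁} b(x)` of a set of vertices. -/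
def vol (G : OFGraph V K) (S : Finset V) : K := ∑ x ∈ S, G.deg x

/-- The weight `b(V₁,V₂) = ∑_{x ∈ V₁, y ∈ V₂} b(x,y)` of the edges between two sets. -/
def cut (G : OFGraph V K) (S T : Finset V) : K := ∑ x ∈ S, ∑ y ∈ T, G.b x y

/-- A vertex is isolated if its weight is zero. -/
def IsIsolated (G : OFGraph V K) (x : V) : Prop := G.deg x = 0

/-- The normalized weight `p(x,y) = b(x,y) / b(x)`. -/
def p (G : OFGraph V K) (x y : V) : K := G.b x y / G.deg x

/-- The normalized Laplace operator on the functions `V → K`. -/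
def laplacian (G : OFGraph V K) : Module.End K (V → K) where
  toFun f x := ∑ y, (f x - f y) * G.p x y
  map_add' f g := by
    funext x
    simp only [Pi.add_apply, ← Finset.sum_add_distrib]
    exact Finset.sum_congr rfl fun y _ => by ring
  map_smul' c f := by
    funext x
    simp only [Pi.smul_apply, smul_eq_mul, RingHom.id_apply, Finset.mul_sum]
    exact Finset.sum_congr rfl fun y _ => by ring

/-- The pairs of nonempty disjoint sets of vertices. -/
def disjointPairs (V : Type*) [Fintype V] [DecidableEq V] : Finset (Finset V × Finset V) :=
  {P | P.1.Nonempty ∧ P.2.Nonempty ∧ Disjoint P.1 P.2}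

theorem disjointPairs_nonempty (V : Type*) [Fintype V] [DecidableEq V] [Nontrivial V] :
    (disjointPairs V).Nonempty := by
  obtain ⟨x, y, hxy⟩ := exists_pair_ne V
  exact ⟨({x}, {y}), by simp [disjointPairs, hxy]⟩

/-- The dual Cheeger constant: the maximum of `2 b(V₁,V₂) / (b(V₁) + b(V₂))` over all pairs of
nonempty disjoint sets of vertices. -/
def dualCheeger [DecidableEq V] [Nontrivial V] (G : OFGraph V K) : K :=
  (disjointPairs V).sup' (disjointPairs_nonempty V)
    fun P => 2 * G.cut P.1 P.2 / (G.vol P.1 + G.vol P.2)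

end OFGraph

/-! The spectral theorem is proved algebraically. Let `T` be self-adjoint for a positive definite
form and let `q` be an irreducible factor of its minimal polynomial, with `v ≠ 0` killed by `q(T)`.
If `g² + h²` vanishes mod `q`, then `g(T)v` and `h(T)v` have squared lengths summing to `0`, so both
vanish. Thus sums of two squares in `K[X]/(q)` vanish only trivially, which over a real closed field
forces degree one: a proper finite extension would contain a square root of some `-e²` outside `K`.
With all eigenvalues in `K` and `lam` the largest, `lam - T` is the square of a polynomial in `T`,
which gives the Rayleigh bound (`exists_isGreatest_hasEigenvalue`).

The lower bound tests this on the difference of two indicators. For the upper bound, Cauchy–Schwarz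
is applied to an eigenfunction, with sign-changing edges treated apart
(`sq_one_sub_dualCheeger_le`). The coarea inequality `sum_min_le` brings in the dual Cheeger
constant. -/

/-! ### Finite extensions of real closed fields -/

open Polynomial in
/-- A real closed field has no proper finite extension of odd degree. -/
theorem IsRealClosed.finrank_eq_one_of_odd {K E : Type*} [Field K] [LinearOrder K]
    [IsStrictOrderedRing K] [IsRealClosed K] [Field E] [Algebra K E] [FiniteDimensional K E]
    (hodd : Odd (Module.finrank K E)) : Module.finrank K E = 1 := by
  obtain ⟨α, hα⟩ := Field.exists_primitive_element K E
  have hint : IsIntegral K α := Algebra.IsIntegral.isIntegral α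
  have hdeg : (minpoly K α).natDegree = Module.finrank K E :=
    (Field.primitive_element_iff_minpoly_natDegree_eq K α).1 hα
  obtain ⟨r, hr⟩ := IsRealClosed.exists_isRoot_of_odd_natDegree (hdeg ▸ hodd)
  rw [← hdeg]
  exact natDegree_eq_of_degree_eq_some
    (degree_eq_one_of_irreducible_of_root (minpoly.irreducible hint) hr)

/-- The Galois group of a finite Galois extension of a real closed field is a `2`-group. -/
theorem IsRealClosed.exists_card_gal_eq_two_pow {K N : Type*} [Field K] [LinearOrder K]
    [IsStrictOrderedRing K] [IsRealClosed K] [Field N] [Algebra K N] [FiniteDimensional K N]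
    [IsGalois K N] : ∃ m : ℕ, Nat.card Gal(N/K) = 2 ^ m := by
  have : Fact (Nat.Prime 2) := ⟨Nat.prime_two⟩
  let P : Sylow 2 Gal(N/K) := default
  have hmul : Module.finrank K (IntermediateField.fixedField (P : Subgroup Gal(N/K))) *
      Nat.card P = Nat.card Gal(N/K) := by
    rw [IsGalois.card_aut_eq_finrank, ← IntermediateField.finrank_fixedField_eq_card,
      Module.finrank_mul_finrank]
  have hindex : (P : Subgroup Gal(N/K)).index =
      Module.finrank K (IntermediateField.fixedField (P : Subgroup Gal(N/K))) := by
    apply Nat.eq_of_mul_eq_mul_right (Nat.card_pos (α := P))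
    rw [hmul]
    exact (P : Subgroup Gal(N/K)).index_mul_card
  have hodd : Odd (Module.finrank K
      (IntermediateField.fixedField (P : Subgroup Gal(N/K)))) := by
    rw [← hindex, ← Nat.not_even_iff_odd, even_iff_two_dvd]
    exact P.not_dvd_index
  rw [IsRealClosed.finrank_eq_one_of_odd hodd, one_mul] at hmul
  rw [← hmul]
  exact ⟨_, P.card_eq_multiplicity⟩

/-- A nontrivial finite extension of a real closed field, embedded in a Galois extension, contains
a quadratic extension. -/
theorem IsRealClosed.exists_le_finrank_eq_two {K N : Type*} [Field K] [LinearOrder K]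
    [IsStrictOrderedRing K] [IsRealClosed K] [Field N] [Algebra K N] [FiniteDimensional K N]
    [IsGalois K N] (F : IntermediateField K N) (hF : F ≠ ⊥) :
    ∃ E : IntermediateField K N, E ≤ F ∧ Module.finrank K E = 2 := by
  have : Fact (Nat.Prime 2) := ⟨Nat.prime_two⟩
  obtain ⟨m, hm⟩ := IsRealClosed.exists_card_gal_eq_two_pow (K := K) (N := N)
  obtain ⟨n, -, hn⟩ := (Nat.dvd_prime_pow Nat.prime_two).1
    (hm ▸ F.fixingSubgroup.card_subgroup_dvd_card)
  have hcard := Module.finrank_mul_finrank K F N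
  rw [← IsGalois.card_fixingSubgroup_eq_finrank F, hn,
    ← IsGalois.card_aut_eq_finrank K N, hm] at hcard
  have hF1 : Module.finrank K F ≠ 1 := fun h => hF (IntermediateField.finrank_eq_one_iff.1 h)
  have hnm : n < m := by
    have h0 : 0 < Module.finrank K F := Module.finrank_pos
    have h2 : 0 < 2 ^ n := by positivity
    have : 2 ^ n < 2 ^ m := by nlinarith [show 2 ≤ Module.finrank K F by lia]
    exact (Nat.pow_lt_pow_iff_right (by norm_num)).1 this
  -- In a 2-group the proper fixing subgroup of `F` lies in a subgroup of index 2, whose fixed field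
  -- is a quadratic extension inside `F`.
  obtain ⟨M, hM, hle⟩ := Sylow.exists_subgroup_card_pow_prime_le 2
    (hm ▸ pow_dvd_pow 2 (Nat.sub_le m 1)) F.fixingSubgroup hn (by lia : n ≤ m - 1)
  refine ⟨IntermediateField.fixedField M, ?_, ?_⟩
  · rw [← IsGalois.fixedField_fixingSubgroup F]
    exact IntermediateField.fixedField_antitone hle
  · have h := Module.finrank_mul_finrank K (IntermediateField.fixedField M) N
    rw [IntermediateField.finrank_fixedField_eq_card, hM,
      ← IsGalois.card_aut_eq_finrank K N, hm] at h
    have : 2 ^ m = 2 * 2 ^ (m - 1) := by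
      rw [← pow_succ', Nat.sub_add_cancel (by lia)]
    rw [this] at h
    exact Nat.eq_of_mul_eq_mul_right (by positivity) h

open Polynomial in
/-- A quadratic extension of a field in which `2` is invertible contains the square root of an
element of the base that has no square root there. -/
theorem exists_sq_eq_algebraMap_of_finrank_eq_two {K E : Type*} [Field K] [CharZero K] [Field E]
    [Algebra K E] (h : Module.finrank K E = 2) :
    ∃ (y : E) (d : K), y ^ 2 = algebraMap K E d ∧ y ∉ (algebraMap K E).range := by
  have : FiniteDimensional K E := Module.finite_of_finrank_pos (by lia)
  obtain ⟨x, hx⟩ := Field.exists_primitive_element K E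
  have hint : IsIntegral K x := Algebra.IsIntegral.isIntegral x
  have hdeg : (minpoly K x).natDegree = 2 :=
    ((Field.primitive_element_iff_minpoly_natDegree_eq K x).1 hx).trans h
  have hx0 := minpoly.aeval K x
  rw [aeval_eq_sum_range, hdeg] at hx0
  have hlead : (minpoly K x).coeff 2 = 1 := hdeg ▸ (minpoly.monic hint).coeff_natDegree
  simp only [Finset.sum_range_succ, Finset.sum_range_zero, hlead, Algebra.smul_def, pow_zero,
    pow_one, map_one] at hx0
  have h2 : (algebraMap K E) 2 ≠ 0 := by simp
  set b := (minpoly K x).coeff 1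
  set c := (minpoly K x).coeff 0
  -- Completing the square in `x² + bx + c = 0`.
  refine ⟨x + algebraMap K E (b / 2), (b / 2) ^ 2 - c, ?_, ?_⟩
  · have hb : algebraMap K E b = 2 * algebraMap K E (b / 2) := by
      rw [← map_ofNat (algebraMap K E) 2, ← map_mul]
      congr 1
      field_simp
    rw [hb] at hx0
    rw [map_sub, map_pow]
    linear_combination hx0
  · rintro ⟨r, hr⟩
    have : x ∈ (algebraMap K E).range :=
      ⟨r - b / 2, by rw [map_sub, hr]; ring⟩
    rw [← minpoly.natDegree_eq_one_iff] at this
    lia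

/-- A real closed field has no proper finite extension in which a sum of two squares vanishes only
trivially. -/
theorem IsRealClosed.finrank_eq_one_of_sq_add_sq {K L : Type*} [Field K] [LinearOrder K]
    [IsStrictOrderedRing K] [IsRealClosed K] [Field L] [Algebra K L] [FiniteDimensional K L]
    (hL : ∀ a b : L, a ^ 2 + b ^ 2 = 0 → a = 0) : Module.finrank K L = 1 := by
  by_contra hne
  let N := IntermediateField.normalClosure K L (AlgebraicClosure L)
  have : IsGalois K N := ⟨⟩
  let φ : L →ₐ[K] N := IsScalarTower.toAlgHom K L N
  have hφ : φ.fieldRange ≠ ⊥ := by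
    intro h
    apply hne
    rw [← IntermediateField.finrank_eq_one_iff] at h
    rw [← h]
    exact (AlgEquiv.ofInjectiveField φ).toLinearEquiv.finrank_eq
  obtain ⟨E, hE, hE2⟩ := IsRealClosed.exists_le_finrank_eq_two φ.fieldRange hφ
  obtain ⟨y, d, hyd, hy⟩ := exists_sq_eq_algebraMap_of_finrank_eq_two hE2
  rcases IsRealClosed.isSquare_or_isSquare_neg d with ⟨e, he⟩ | ⟨e, he⟩
  · rw [he, ← pow_two, map_pow, sq_eq_sq_iff_eq_or_eq_neg] at hyd
    rcases hyd with h | h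
    · exact hy ⟨e, h.symm⟩
    · exact hy ⟨-e, by rw [map_neg, h]⟩
  -- Here `y² = d = -e²`, and `y` comes from `z` in `L`, so `z² + e² = 0`.
  · obtain ⟨z, hz⟩ := hE y.2
    have hz0 : z = 0 := by
      apply hL z (algebraMap K L e)
      apply φ.injective
      change φ _ = φ _
      have h1 : (y : N) ^ 2 = algebraMap K N d := congrArg Subtype.val hyd
      have h2 : φ z = (y : N) := hz
      rw [map_add, map_pow, map_pow, h2, h1, AlgHom.commutes, map_zero, ← map_pow, ← map_add,
        pow_two, ← he, add_neg_cancel, map_zero]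
    apply hy
    refine ⟨0, ?_⟩
    have h2 : φ z = (y : N) := hz
    rw [hz0, map_zero] at h2
    rw [map_zero]
    exact Subtype.ext h2

/-! ### Self-adjoint endomorphisms over a real closed field -/

open Polynomial in
/-- A monic polynomial that splits divides a power of the
product of the linear factors of its distinct roots. -/
theorem Polynomial.Splits.dvd_prod_roots_toFinset_pow {K : Type*} [Field K] [DecidableEq K]
    {p : K[X]} (hp : p.Splits) (hm : p.Monic) :
    p ∣ (∏ a ∈ p.roots.toFinset, (X - C a)) ^ p.roots.card := by
  conv_lhs => rw [hp.eq_prod_roots_of_monic hm]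
  rw [← Multiset.prod_replicate, ← Multiset.map_const']
  exact Multiset.prod_dvd_prod_of_dvd _ _ fun a ha =>
    Finset.dvd_prod_of_mem _ (Multiset.mem_toFinset.2 ha)

open Polynomial in
/-- Polynomials in a self-adjoint endomorphism are self-adjoint. -/
theorem LinearMap.BilinForm.apply_aeval_left {K M : Type*} [CommRing K] [AddCommGroup M]
    [Module K M] (B : LinearMap.BilinForm K M) {T : Module.End K M}
    (hT : ∀ v w, B (T v) w = B v (T w)) (g : K[X]) (v w : M) :
    B (aeval T g v) w = B v (aeval T g w) := by
  induction g using Polynomial.induction_on' generalizing v w with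
  | add p q hp hq => simp [hp, hq]
  | monomial n a =>
    rw [aeval_monomial]
    have hpow : ∀ (n : ℕ) (v w : M), B ((T ^ n) v) w = B v ((T ^ n) w) := by
      intro n
      induction n with
      | zero => simp
      | succ n ih =>
        intro v w
        rw [pow_succ, Module.End.mul_apply, ih, hT, ← Module.End.mul_apply, ← pow_succ',
          pow_succ]
    simp [hpow, Module.algebraMap_end_apply]

open Polynomial in
/-- A self-adjoint endomorphism with respect to a positive definite form over a real closed field
has a minimal polynomial that splits. -/
theorem LinearMap.BilinForm.splits_minpoly {K M : Type*} [Field K] [LinearOrder K]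
    [IsStrictOrderedRing K] [IsRealClosed K] [AddCommGroup M] [Module K M] [FiniteDimensional K M]
    (B : LinearMap.BilinForm K M) (hB : ∀ v, v ≠ 0 → 0 < B v v) {T : Module.End K M}
    (hT : ∀ v w, B (T v) w = B v (T w)) : (minpoly K T).Splits := by
  have hint : IsIntegral K T := Algebra.IsIntegral.isIntegral T
  suffices key : ∀ q : K[X], Irreducible q → q ∣ minpoly K T → degree q = 1 by
    obtain ⟨u, hu⟩ := UniqueFactorizationMonoid.factors_prod (minpoly.ne_zero hint)
    rw [← hu]
    exact (Splits.multisetProd fun g hg => Splits.of_degree_eq_one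
      (key g (UniqueFactorizationMonoid.irreducible_of_factor g hg)
        (UniqueFactorizationMonoid.dvd_of_mem_factors hg))).mul u.isUnit.splits
  intro q hq hdvd
  obtain ⟨r, hr⟩ := hdvd
  have hq0 : q ≠ 0 := hq.ne_zero
  have hr0 : r ≠ 0 := fun h => minpoly.ne_zero hint (by rw [hr, h, mul_zero])
  -- The cofactor `r` has smaller degree than the minimal polynomial, so it cannot annihilate `T`.
  obtain ⟨w, hw⟩ : ∃ w, aeval T r w ≠ 0 := by
    by_contra! hcon
    have h1 := minpoly.degree_le_of_ne_zero K T hr0 (LinearMap.ext hcon)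
    rw [hr, degree_mul, degree_eq_natDegree hq0, degree_eq_natDegree hr0] at h1
    have h2 : 0 < q.natDegree := hq.natDegree_pos
    norm_cast at h1
    lia
  obtain ⟨v, hw, hv⟩ : ∃ v, v ≠ 0 ∧ aeval T q v = 0 := ⟨aeval T r w, hw, by
    rw [← Module.End.mul_apply, ← map_mul, ← hr, minpoly.aeval, LinearMap.zero_apply]⟩
  have hdvd : ∀ g : K[X], q ∣ g → aeval T g v = 0 := by
    rintro _ ⟨g, rfl⟩
    rw [mul_comm, map_mul, Module.End.mul_apply, hv, map_zero]
  -- By Bézout, `q` generates the annihilator of `v`.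
  have hdvd' : ∀ g : K[X], aeval T g v = 0 → q ∣ g := by
    intro g hg
    by_contra hng
    obtain ⟨a, b, hab⟩ := (hq.coprime_iff_not_dvd).2 hng
    have : aeval T (a * q + b * g) v = 0 := by
      simp [hv, hg]
    rw [hab, map_one] at this
    exact hw this
  have : Fact (Irreducible q) := ⟨hq⟩
  have : FiniteDimensional K (AdjoinRoot q) := (AdjoinRoot.powerBasis hq0).finite
  have hone : Module.finrank K (AdjoinRoot q) = 1 := by
    apply IsRealClosed.finrank_eq_one_of_sq_add_sq
    intro x y hxy
    obtain ⟨g, rfl⟩ := AdjoinRoot.mk_surjective x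
    obtain ⟨h, rfl⟩ := AdjoinRoot.mk_surjective y
    rw [← map_pow, ← map_pow, ← map_add, AdjoinRoot.mk_eq_zero] at hxy
    have hnn : ∀ u, 0 ≤ B u u := fun u => by
      rcases eq_or_ne u 0 with rfl | hu
      · simp
      · exact (hB u hu).le
    have hsum : B (aeval T g v) (aeval T g v) + B (aeval T h v) (aeval T h v) = 0 := by
      rw [B.apply_aeval_left hT g v, B.apply_aeval_left hT h v, ← map_add, ← Module.End.mul_apply,
        ← Module.End.mul_apply, ← map_mul, ← map_mul, ← LinearMap.add_apply, ← map_add,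
        ← pow_two, ← pow_two, hdvd _ hxy, map_zero]
    rw [AdjoinRoot.mk_eq_zero]
    apply hdvd'
    by_contra hne
    linarith [hB _ hne, hnn (aeval T h v)]
  rw [(AdjoinRoot.powerBasis hq0).finrank, AdjoinRoot.powerBasis_dim] at hone
  rw [degree_eq_natDegree hq0, hone]
  rfl

open Polynomial in
/-- The product of the linear factors of the distinct eigenvalues annihilates a self-adjoint
endomorphism. -/
theorem LinearMap.BilinForm.aeval_prod_roots_eq_zero {K M : Type*} [Field K] [LinearOrder K]
    [IsStrictOrderedRing K] [IsRealClosed K] [AddCommGroup M] [Module K M] [FiniteDimensional K M]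
    (B : LinearMap.BilinForm K M) (hB : ∀ v, v ≠ 0 → 0 < B v v) {T : Module.End K M}
    (hT : ∀ v w, B (T v) w = B v (T w)) :
    aeval T (∏ a ∈ (minpoly K T).roots.toFinset, (X - C a)) = 0 := by
  have hint : IsIntegral K T := Algebra.IsIntegral.isIntegral T
  set p := ∏ a ∈ (minpoly K T).roots.toFinset, (X - C a)
  -- Definiteness rules out nilpotents: `B(g(T)v, g(T)v) = B(v, g(T)²v)`. Exponents that are powers
  -- of two can then be halved down to 1.
  have hsq : ∀ g : K[X], aeval T (g ^ 2) = 0 → aeval T g = 0 := by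
    intro g hg
    ext v
    by_contra hne
    have h := hB _ hne
    rw [B.apply_aeval_left hT, ← Module.End.mul_apply, ← map_mul, ← pow_two, hg,
      LinearMap.zero_apply, map_zero] at h
    exact lt_irrefl _ h
  have hpow : ∀ k : ℕ, aeval T (p ^ 2 ^ k) = 0 → aeval T p = 0 := by
    intro k
    induction k with
    | zero => simp
    | succ k ih => exact fun h => ih (hsq _ (by rwa [← pow_mul, ← pow_succ]))
  apply hpow (minpoly K T).roots.card
  rw [← minpoly.dvd_iff]
  exact ((B.splits_minpoly hB hT).dvd_prod_roots_toFinset_pow (minpoly.monic hint)).trans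
    (pow_dvd_pow _ Nat.lt_two_pow_self.le)

open Polynomial in
/-- Over a real closed field, the Rayleigh quotients of a self-adjoint endomorphism are bounded
by its largest eigenvalue. -/
theorem LinearMap.BilinForm.exists_isGreatest_hasEigenvalue {K M : Type*} [Field K] [LinearOrder K]
    [IsStrictOrderedRing K] [IsRealClosed K] [AddCommGroup M] [Module K M] [FiniteDimensional K M]
    [Nontrivial M] (B : LinearMap.BilinForm K M) (hB : ∀ v, v ≠ 0 → 0 < B v v)
    {T : Module.End K M} (hT : ∀ v w, B (T v) w = B v (T w)) :
    ∃ lam : K, IsGreatest {μ : K | T.HasEigenvalue μ} lam ∧ ∀ v, B v (T v) ≤ lam * B v v := by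
  have hint : IsIntegral K T := Algebra.IsIntegral.isIntegral T
  have hne : (minpoly K T).roots.toFinset.Nonempty := by
    rw [Multiset.toFinset_nonempty]
    exact (B.splits_minpoly hB hT).roots_ne_zero (minpoly.natDegree_pos hint).ne'
  have hmem : ∀ μ, μ ∈ (minpoly K T).roots.toFinset ↔ T.HasEigenvalue μ := by
    intro μ
    rw [Multiset.mem_toFinset, mem_roots (minpoly.ne_zero hint),
      Module.End.hasEigenvalue_iff_isRoot]
  set S := (minpoly K T).roots.toFinset with hS
  have hle : ∀ μ ∈ S, μ ≤ S.max' hne := fun μ hμ => S.le_max' μ hμ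
  refine ⟨S.max' hne, ⟨(hmem _).1 (S.max'_mem hne), fun μ hμ => hle μ ((hmem μ).2 hμ)⟩, ?_⟩
  set lam := S.max' hne
  -- Interpolating these roots makes `g(T)` a square root of `lam - T`; the value 0 off `S` is a
  -- dummy.
  have hroot : ∀ μ : K, ∃ s : K, μ ∈ S → s ^ 2 = lam - μ := by
    intro μ
    by_cases hμ : μ ∈ S
    · obtain ⟨s, hs⟩ := IsSquare.of_nonneg (sub_nonneg.2 (hle μ hμ))
      exact ⟨s, fun _ => by rw [hs, pow_two]⟩
    · exact ⟨0, fun h => absurd h hμ⟩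
  choose s hs using hroot
  let g : K[X] := Lagrange.interpolate S _root_.id s
  have hg : ∀ μ ∈ S, g.eval μ = s μ := fun μ hμ =>
    Lagrange.eval_interpolate_at_node (v := _root_.id) s Function.injective_id.injOn hμ
  have hdvd : ∏ a ∈ S, (X - C a) ∣ g ^ 2 - (C lam - X) := by
    apply Finset.prod_dvd_of_coprime
    · exact fun a _ b _ hab => (pairwise_coprime_X_sub_C (Function.injective_id (α := K))) hab
    · intro a ha
      rw [dvd_iff_isRoot]
      simp [hg a ha, hs a ha]
  have hzero : aeval T (g ^ 2 - (C lam - X)) = 0 := by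
    obtain ⟨r, hr⟩ := hdvd
    rw [hr, map_mul, B.aeval_prod_roots_eq_zero hB hT, zero_mul]
  intro v
  have h1 : B (aeval T g v) (aeval T g v) = lam * B v v - B v (T v) := by
    rw [map_sub, sub_eq_zero] at hzero
    rw [B.apply_aeval_left hT, ← Module.End.mul_apply, ← map_mul, ← pow_two, hzero]
    simp [Module.algebraMap_end_apply]
  have h2 : 0 ≤ B (aeval T g v) (aeval T g v) := by
    rcases eq_or_ne (aeval T g v) 0 with h | h
    · simp [h]
    · exact (hB _ h).le
  linarith

/-! ### The weighted inner product and the energy form -/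

namespace OFGraph

/-- The inner product `∑ x, b(x) f(x) g(x)` on functions. -/
def form {V K : Type*} [Fintype V] [Field K] [LinearOrder K] (G : OFGraph V K) :
    LinearMap.BilinForm K (V → K) :=
  LinearMap.mk₂ K (fun f g => ∑ x, G.deg x * (f x * g x))
    (fun f f' g => by
      rw [← Finset.sum_add_distrib]
      exact Finset.sum_congr rfl fun x _ => by simp only [Pi.add_apply]; ring)
    (fun c f g => by
      rw [smul_eq_mul, Finset.mul_sum]
      exact Finset.sum_congr rfl fun x _ => by simp only [Pi.smul_apply, smul_eq_mul]; ring)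
    (fun f g g' => by
      rw [← Finset.sum_add_distrib]
      exact Finset.sum_congr rfl fun x _ => by simp only [Pi.add_apply]; ring)
    (fun c f g => by
      rw [smul_eq_mul, Finset.mul_sum]
      exact Finset.sum_congr rfl fun x _ => by simp only [Pi.smul_apply, smul_eq_mul]; ring)

theorem cut_comm {V K : Type*} [Field K] [LinearOrder K] (G : OFGraph V K) (S T : Finset V) :
    G.cut S T = G.cut T S := by
  rw [cut, cut, Finset.sum_comm]
  simp only [G.symm]

theorem cut_nonneg {V K : Type*} [Field K] [LinearOrder K] [IsStrictOrderedRing K]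
    (G : OFGraph V K) (S T : Finset V) : 0 ≤ G.cut S T :=
  Finset.sum_nonneg fun x _ => Finset.sum_nonneg fun y _ => G.nonneg x y

variable {V K : Type*} [Fintype V] [Field K] [LinearOrder K]

theorem form_apply (G : OFGraph V K) (f g : V → K) :
    G.form f g = ∑ x, G.deg x * (f x * g x) := rfl

/-- Summing a function of the first endpoint over all edges. -/
theorem sum_b_mul_left (G : OFGraph V K) (u : V → K) :
    ∑ x, ∑ y, G.b x y * u x = ∑ x, G.deg x * u x := by
  simp only [deg, Finset.sum_mul]

/-- Summing a function of the second endpoint over all edges. -/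
theorem sum_b_mul_right (G : OFGraph V K) (u : V → K) :
    ∑ x, ∑ y, G.b x y * u y = ∑ x, G.deg x * u x := by
  rw [← G.sum_b_mul_left, Finset.sum_comm]
  simp only [G.symm]

theorem form_laplacian (G : OFGraph V K) (hG : ∀ x, ¬ G.IsIsolated x) (f g : V → K) :
    G.form f (G.laplacian g) = ∑ x, ∑ y, G.b x y * (f x * (g x - g y)) := by
  rw [form_apply]
  refine Finset.sum_congr rfl fun x _ => ?_
  have hx : G.deg x ≠ 0 := hG x
  change G.deg x * (f x * ∑ y, (g x - g y) * (G.b x y / G.deg x)) = _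
  rw [Finset.mul_sum, Finset.mul_sum]
  exact Finset.sum_congr rfl fun y _ => by field_simp

/-- Averaging over the two orientations of each edge gives an expression symmetric in `f` and `g`;
self-adjointness follows. -/
theorem two_mul_form_laplacian (G : OFGraph V K) (hG : ∀ x, ¬ G.IsIsolated x) (f g : V → K) :
    2 * G.form f (G.laplacian g) = ∑ x, ∑ y, G.b x y * ((f x - f y) * (g x - g y)) := by
  have h : ∑ x, ∑ y, G.b x y * (f x * (g x - g y)) =
      ∑ x, ∑ y, G.b x y * (f y * (g y - g x)) := by
    rw [Finset.sum_comm]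
    simp only [G.symm]
  rw [two_mul]
  nth_rw 1 [G.form_laplacian hG]
  rw [G.form_laplacian hG, h, ← h]
  nth_rw 2 [h]
  simp only [← Finset.sum_add_distrib]
  exact Finset.sum_congr rfl fun x _ => Finset.sum_congr rfl fun y _ => by ring

variable [IsStrictOrderedRing K]

theorem form_laplacian_left (G : OFGraph V K) (hG : ∀ x, ¬ G.IsIsolated x) (f g : V → K) :
    G.form (G.laplacian f) g = G.form f (G.laplacian g) := by
  have h1 := G.two_mul_form_laplacian hG f g
  have h2 := G.two_mul_form_laplacian hG g f
  have h3 : G.form (G.laplacian f) g = G.form g (G.laplacian f) := by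
    simp only [form_apply]
    exact Finset.sum_congr rfl fun x _ => by ring
  have h4 : ∑ x, ∑ y, G.b x y * ((f x - f y) * (g x - g y)) =
      ∑ x, ∑ y, G.b x y * ((g x - g y) * (f x - f y)) :=
    Finset.sum_congr rfl fun x _ => Finset.sum_congr rfl fun y _ => by ring
  linarith

theorem deg_nonneg (G : OFGraph V K) (x : V) : 0 ≤ G.deg x :=
  Finset.sum_nonneg fun y _ => G.nonneg x y

theorem deg_pos (G : OFGraph V K) (hG : ∀ x, ¬ G.IsIsolated x) (x : V) : 0 < G.deg x :=
  lt_of_le_of_ne (G.deg_nonneg x) (Ne.symm (hG x))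

theorem form_self_pos (G : OFGraph V K) (hG : ∀ x, ¬ G.IsIsolated x) (f : V → K) (hf : f ≠ 0) :
    0 < G.form f f := by
  obtain ⟨x, hx⟩ := Function.ne_iff.1 hf
  rw [form_apply]
  exact Finset.sum_pos' (fun y _ => mul_nonneg (G.deg_nonneg y) (mul_self_nonneg _))
    ⟨x, Finset.mem_univ x, mul_pos (G.deg_pos hG x) (mul_self_pos.2 hx)⟩

theorem vol_nonneg (G : OFGraph V K) (S : Finset V) : 0 ≤ G.vol S :=
  Finset.sum_nonneg fun x _ => G.deg_nonneg x

theorem vol_pos (G : OFGraph V K) (hG : ∀ x, ¬ G.IsIsolated x) {S : Finset V} (hS : S.Nonempty) :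
    0 < G.vol S :=
  Finset.sum_pos (fun x _ => G.deg_pos hG x) hS

theorem cut_le_vol (G : OFGraph V K) (S T : Finset V) : G.cut S T ≤ G.vol S :=
  Finset.sum_le_sum fun x _ =>
    Finset.sum_le_sum_of_subset_of_nonneg T.subset_univ fun y _ _ => G.nonneg x y

/-! ### The dual Cheeger constant and the coarea inequality -/

section Cheeger

variable [DecidableEq V] [Nontrivial V]

theorem dualCheeger_nonneg (G : OFGraph V K) : 0 ≤ G.dualCheeger := by
  obtain ⟨P, hP⟩ := disjointPairs_nonempty V
  refine le_trans ?_ (Finset.le_sup' (fun P : Finset V × Finset V =>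
    2 * G.cut P.1 P.2 / (G.vol P.1 + G.vol P.2)) hP)
  exact div_nonneg (mul_nonneg zero_le_two (G.cut_nonneg _ _))
    (add_nonneg (G.vol_nonneg _) (G.vol_nonneg _))

theorem dualCheeger_le_one (G : OFGraph V K) : G.dualCheeger ≤ 1 := by
  refine Finset.sup'_le _ _ fun P _ => ?_
  refine div_le_one_of_le₀ ?_ (add_nonneg (G.vol_nonneg _) (G.vol_nonneg _))
  have h1 := G.cut_le_vol P.1 P.2
  have h2 := G.cut_le_vol P.2 P.1
  rw [G.cut_comm] at h2
  linarith

/-- Empty sets are admitted because the level sets in the coarea argument may miss `S` or `T`. -/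
theorem two_mul_cut_le (G : OFGraph V K) (hG : ∀ x, ¬ G.IsIsolated x) {S T : Finset V}
    (h : Disjoint S T) : 2 * G.cut S T ≤ G.dualCheeger * (G.vol S + G.vol T) := by
  by_cases hST : S.Nonempty ∧ T.Nonempty
  · rw [← div_le_iff₀ (add_pos (G.vol_pos hG hST.1) (G.vol_pos hG hST.2))]
    exact Finset.le_sup' (fun P : Finset V × Finset V =>
      2 * G.cut P.1 P.2 / (G.vol P.1 + G.vol P.2)) (b := (S, T))
      (by simp [disjointPairs, hST.1, hST.2, h])
  · have : G.cut S T = 0 := by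
      rw [not_and_or, Finset.not_nonempty_iff_eq_empty, Finset.not_nonempty_iff_eq_empty] at hST
      rcases hST with rfl | rfl <;> simp [cut]
    rw [this, mul_zero]
    exact mul_nonneg G.dualCheeger_nonneg (add_nonneg (G.vol_nonneg _) (G.vol_nonneg _))

/-- A discrete coarea inequality for the dual Cheeger constant. -/
theorem sum_min_le (G : OFGraph V K) (hG : ∀ x, ¬ G.IsIsolated x) (u : V → K)
    (hu : ∀ x, 0 ≤ u x) {S T : Finset V} (h : Disjoint S T) :
    2 * ∑ x ∈ S, ∑ y ∈ T, G.b x y * min (u x) (u y) ≤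
      G.dualCheeger * (∑ x ∈ S, G.deg x * u x + ∑ x ∈ T, G.deg x * u x) := by
  induction hn : ({x | 0 < u x} : Finset V).card using Nat.strong_induction_on generalizing u with
  | _ n ih =>
    set A : Finset V := {x | 0 < u x} with hA
    rcases A.eq_empty_or_nonempty with hemp | hne
    · have h0 : ∀ x, u x = 0 := fun x => by
        refine le_antisymm ?_ (hu x)
        by_contra hx
        have : x ∈ A := by simpa [hA] using hx
        simp [hemp] at this
      simp [h0]
    · obtain ⟨a, ha, hmin⟩ := A.exists_min_image u hne
      have hapos : 0 < u a := by simpa [hA] using ha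
      -- Peel off the lowest layer: subtracting the least positive value on the support removes `a`
      -- from it, and the layer itself is a cut estimate.
      let u' : V → K := fun x => u x - if x ∈ A then u a else 0
      have hu' : ∀ x, 0 ≤ u' x := fun x => by
        by_cases hx : x ∈ A
        · simpa [u', hx] using hmin x hx
        · simpa [u', hx] using hu x
      have hzero : ∀ x, x ∉ A → u x = 0 := fun x hx =>
        le_antisymm (by simpa [hA] using hx) (hu x)
      have hlt : ({x | 0 < u' x} : Finset V).card < n := by
        rw [← hn]
        refine Finset.card_lt_card ⟨fun x hx => ?_, fun hsub => ?_⟩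
        · by_contra hxA
          simp [u', hxA, hzero x hxA] at hx
        · simpa [u', ha] using hsub ha
      have key := ih _ hlt u' hu' rfl
      have hcut := G.two_mul_cut_le hG
        (h.mono (Finset.filter_subset (· ∈ A) S) (Finset.filter_subset (· ∈ A) T))
      have hsum : ∀ R : Finset V, ∑ x ∈ R, G.deg x * u x =
          ∑ x ∈ R, G.deg x * u' x + u a * G.vol (R.filter (· ∈ A)) := by
        intro R
        rw [vol, Finset.sum_filter, Finset.mul_sum, ← Finset.sum_add_distrib]
        refine Finset.sum_congr rfl fun x _ => ?_
        by_cases hx : x ∈ A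
        · simp only [u', hx, if_true]; ring
        · simp [u', hx]
      have hmins : ∑ x ∈ S, ∑ y ∈ T, G.b x y * min (u x) (u y) =
          ∑ x ∈ S, ∑ y ∈ T, G.b x y * min (u' x) (u' y) +
            u a * G.cut (S.filter (· ∈ A)) (T.filter (· ∈ A)) := by
        rw [cut, Finset.sum_filter, Finset.mul_sum, ← Finset.sum_add_distrib]
        refine Finset.sum_congr rfl fun x _ => ?_
        by_cases hx : x ∈ A
        · rw [if_pos hx, Finset.sum_filter, Finset.mul_sum, ← Finset.sum_add_distrib]
          refine Finset.sum_congr rfl fun y _ => ?_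
          by_cases hy : y ∈ A
          · simp only [u', hx, hy, if_true, min_sub_sub_right]; ring
          · have : 0 ≤ u x - u a := sub_nonneg.2 (hmin x hx)
            simp [u', hx, hy, hzero y hy, hu x, this]
        · rw [if_neg hx, mul_zero, add_zero]
          refine Finset.sum_congr rfl fun y _ => ?_
          have h1 : u' x = 0 := by simp [u', hx, hzero x hx]
          rw [h1, hzero x hx, min_eq_left (hu y), min_eq_left (hu' y)]
      rw [hmins, hsum S, hsum T]
      have := mul_le_mul_of_nonneg_left hcut hapos.le
      linarith

/-- The edges on which a function changes sign carry a controlled part of its energy. -/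
theorem sum_opposite_min_le (G : OFGraph V K) (hG : ∀ x, ¬ G.IsIsolated x) (f : V → K) :
    ∑ x, ∑ y, G.b x y * (if f x * f y < 0 then min (f x ^ 2) (f y ^ 2) else 0) ≤
      G.dualCheeger * G.form f f := by
  let S : Finset V := {x | 0 < f x}
  let T : Finset V := {x | f x < 0}
  have hST : Disjoint S T := by
    rw [Finset.disjoint_filter]
    exact fun x _ hx hx' => lt_asymm hx hx'
  have hmain := G.sum_min_le hG (fun x => f x ^ 2) (fun x => sq_nonneg _) hST
  -- The ordered sum meets each sign-changing edge in both orientations, matching the factor 2 in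
  -- the coarea inequality.
  have hsplit : ∑ x, ∑ y, G.b x y * (if f x * f y < 0 then min (f x ^ 2) (f y ^ 2) else 0) =
      ∑ x ∈ S, ∑ y ∈ T, G.b x y * min (f x ^ 2) (f y ^ 2) +
        ∑ y ∈ T, ∑ x ∈ S, G.b y x * min (f y ^ 2) (f x ^ 2) := by
    simp only [S, T, Finset.sum_filter, ← Finset.sum_add_distrib]
    refine Finset.sum_congr rfl fun x _ => ?_
    rcases lt_trichotomy (f x) 0 with hx | hx | hx
    · simp only [hx, hx.not_gt, if_true, if_false, zero_add]
      refine Finset.sum_congr rfl fun y _ => ?_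
      simp [mul_neg_iff, hx, hx.not_gt]
    · simp [hx]
    · simp only [hx, hx.not_gt, if_true, if_false, add_zero]
      refine Finset.sum_congr rfl fun y _ => ?_
      simp [mul_neg_iff, hx, hx.not_gt]
  have hswap : ∑ y ∈ T, ∑ x ∈ S, G.b y x * min (f y ^ 2) (f x ^ 2) =
      ∑ x ∈ S, ∑ y ∈ T, G.b x y * min (f x ^ 2) (f y ^ 2) := by
    rw [Finset.sum_comm]
    exact Finset.sum_congr rfl fun x _ => Finset.sum_congr rfl fun y _ => by
      rw [G.symm, min_comm]
  have hform : ∑ x ∈ S, G.deg x * f x ^ 2 + ∑ x ∈ T, G.deg x * f x ^ 2 ≤ G.form f f := by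
    rw [← Finset.sum_union hST, form_apply]
    simp only [← pow_two]
    exact Finset.sum_le_sum_of_subset_of_nonneg (Finset.subset_univ _)
      fun x _ _ => mul_nonneg (G.deg_nonneg x) (sq_nonneg _)
  rw [hsplit, hswap, ← two_mul]
  exact hmain.trans (mul_le_mul_of_nonneg_left hform G.dualCheeger_nonneg)

/-! ### The two eigenvalue bounds -/

/-- Twice the dual Cheeger constant is a lower bound for every upper bound of the Rayleigh
quotients. -/
theorem two_mul_dualCheeger_le (G : OFGraph V K) (hG : ∀ x, ¬ G.IsIsolated x) {lam : K}
    (hlam : ∀ f, G.form f (G.laplacian f) ≤ lam * G.form f f) : 2 * G.dualCheeger ≤ lam := by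
  rw [← le_div_iff₀' two_pos]
  refine Finset.sup'_le _ _ fun P hP => ?_
  obtain ⟨S, T⟩ := P
  simp only [disjointPairs, Finset.mem_filter, Finset.mem_univ, true_and] at hP
  obtain ⟨hS, hT, hST⟩ := hP
  dsimp only
  rw [div_le_iff₀ (add_pos (G.vol_pos hG hS) (G.vol_pos hG hT))]
  let f : V → K := fun x => (if x ∈ S then 1 else 0) - (if x ∈ T then 1 else 0)
  have hform : G.form f f = G.vol S + G.vol T := by
    rw [form_apply, vol, vol, ← Finset.sum_union hST,
      ← Finset.sum_subset (Finset.subset_univ (S ∪ T))]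
    · refine Finset.sum_congr rfl fun x hx => ?_
      rcases Finset.mem_union.1 hx with h | h
      · simp [f, h, Finset.disjoint_left.1 hST h]
      · simp [f, h, Finset.disjoint_right.1 hST h]
    · intro x _ hx
      rw [Finset.mem_union, not_or] at hx
      simp [f, hx.1, hx.2]
  have hcut : ∀ A B : Finset V, G.cut A B =
      ∑ x, ∑ y, G.b x y * ((if x ∈ A then 1 else 0) * (if y ∈ B then 1 else 0)) := by
    intro A B
    simp [cut, Finset.sum_ite_mem]
  -- Between `S` and `T` the function jumps by 2, hence the 4; all other pairs are discarded.
  have hpoint : ∀ x y, 4 * ((if x ∈ S then 1 else 0) * (if y ∈ T then 1 else 0)) +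
      4 * ((if x ∈ T then 1 else 0) * (if y ∈ S then (1 : K) else 0)) ≤
        (f x - f y) * (f x - f y) := by
    intro x y
    have h1 : x ∈ S → x ∉ T := fun h => Finset.disjoint_left.1 hST h
    have h2 : y ∈ S → y ∉ T := fun h => Finset.disjoint_left.1 hST h
    by_cases hxS : x ∈ S <;> by_cases hxT : x ∈ T <;> by_cases hyS : y ∈ S <;>
      by_cases hyT : y ∈ T <;> simp_all [f] <;> norm_num
  have henergy : 4 * G.cut S T + 4 * G.cut T S ≤ 2 * G.form f (G.laplacian f) := by
    rw [G.two_mul_form_laplacian hG, hcut S T, hcut T S]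
    simp only [Finset.mul_sum, ← Finset.sum_add_distrib]
    refine Finset.sum_le_sum fun x _ => Finset.sum_le_sum fun y _ => ?_
    have := mul_le_mul_of_nonneg_left (hpoint x y) (G.nonneg x y)
    linarith
  have h := hlam f
  rw [hform] at h
  rw [G.cut_comm T S] at henergy
  linarith

/-- The dual Cheeger inequality for an eigenvalue of the normalized Laplacian. -/
theorem sq_one_sub_dualCheeger_le (G : OFGraph V K) (hG : ∀ x, ¬ G.IsIsolated x) {μ : K}
    (hμ : G.laplacian.HasEigenvalue μ) :
    ∃ a : K, a ≤ 2 - μ ∧ (1 - G.dualCheeger) ^ 2 ≤ a * (2 - a) := by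
  obtain ⟨f, hf⟩ := hμ.exists_hasEigenvector
  have hpos := G.form_self_pos hG f hf.2
  set F := G.form f f with hF
  have hlap : 2 * (μ * F) = ∑ x, ∑ y, G.b x y * ((f x - f y) * (f x - f y)) := by
    rw [← G.two_mul_form_laplacian hG, hf.apply_eq_smul, map_smul, smul_eq_mul]
  have htot : ∑ x, ∑ y, G.b x y * (f x ^ 2 + f y ^ 2) = 2 * F := by
    simp only [mul_add, Finset.sum_add_distrib]
    rw [G.sum_b_mul_left (fun x => f x ^ 2), G.sum_b_mul_right (fun x => f x ^ 2), hF, form_apply,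
      ← two_mul]
    simp only [pow_two]
  -- On every edge `δ² = αγ`. Without a sign change, `(f x + f y)² ≥ f x² + f y²`, so `α` never
  -- exceeds `(f x + f y)²`.
  let α : V → V → K := fun x y => if f x * f y < 0 then (f x + f y) ^ 2 else f x ^ 2 + f y ^ 2
  let γ : V → V → K := fun x y => if f x * f y < 0 then (f x - f y) ^ 2 else f x ^ 2 + f y ^ 2
  let δ : V → V → K := fun x y =>
    if f x * f y < 0 then |f x ^ 2 - f y ^ 2| else f x ^ 2 + f y ^ 2
  set α' := ∑ x, ∑ y, G.b x y * α x y
  set γ' := ∑ x, ∑ y, G.b x y * γ x y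
  set δ' := ∑ x, ∑ y, G.b x y * δ x y
  have hαγ : α' + γ' = 4 * F := by
    have : α' + γ' = 2 * ∑ x, ∑ y, G.b x y * (f x ^ 2 + f y ^ 2) := by
      simp only [α', γ', Finset.mul_sum, ← Finset.sum_add_distrib]
      refine Finset.sum_congr rfl fun x _ => Finset.sum_congr rfl fun y _ => ?_
      by_cases h : f x * f y < 0 <;> simp only [α, γ, h, if_true, if_false] <;> ring
    rw [this, htot]
    ring
  have hα : α' ≤ 2 * (2 - μ) * F := by
    have : α' + 2 * (μ * F) ≤ 2 * ∑ x, ∑ y, G.b x y * (f x ^ 2 + f y ^ 2) := by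
      rw [hlap]
      simp only [α', Finset.mul_sum, ← Finset.sum_add_distrib]
      refine Finset.sum_le_sum fun x _ => Finset.sum_le_sum fun y _ => ?_
      rw [← mul_add, mul_left_comm]
      refine mul_le_mul_of_nonneg_left ?_ (G.nonneg x y)
      by_cases h : f x * f y < 0 <;> simp only [α, h, if_true, if_false] <;> nlinarith
    rw [htot] at this
    linarith
  have hδ : 2 * (1 - G.dualCheeger) * F ≤ δ' := by
    have : δ' = ∑ x, ∑ y, G.b x y * (f x ^ 2 + f y ^ 2) - 2 *
        ∑ x, ∑ y, G.b x y * (if f x * f y < 0 then min (f x ^ 2) (f y ^ 2) else 0) := by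
      simp only [δ', Finset.mul_sum, ← Finset.sum_sub_distrib]
      refine Finset.sum_congr rfl fun x _ => Finset.sum_congr rfl fun y _ => ?_
      by_cases h : f x * f y < 0
      · simp only [δ, h, if_true]
        rcases le_total (f x ^ 2) (f y ^ 2) with hle | hle
        · rw [min_eq_left hle, abs_of_nonpos (sub_nonpos.2 hle)]; ring
        · rw [min_eq_right hle, abs_of_nonneg (sub_nonneg.2 hle)]; ring
      · simp [δ, h]
    have hopp := G.sum_opposite_min_le hG f
    rw [this, htot]
    linarith
  -- Cauchy–Schwarz `δ'² ≤ α'γ'`, read off from a quadratic in `t` that is nonnegative on each edge.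
  have hdisc : discrim γ' (-2 * δ') α' ≤ 0 := by
    refine discrim_le_zero fun t => ?_
    have : γ' * (t * t) + -2 * δ' * t + α' =
        ∑ x, ∑ y, G.b x y * (γ x y * (t * t) - 2 * δ x y * t + α x y) := by
      simp only [α', γ', δ', Finset.mul_sum, Finset.sum_mul, ← Finset.sum_add_distrib]
      exact Finset.sum_congr rfl fun x _ => Finset.sum_congr rfl fun y _ => by ring
    rw [this]
    refine Finset.sum_nonneg fun x _ => Finset.sum_nonneg fun y _ =>
      mul_nonneg (G.nonneg x y) ?_
    by_cases h : f x * f y < 0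
    · simp only [α, γ, δ, h, if_true]
      have h1 : |f x ^ 2 - f y ^ 2| = |f x + f y| * |f x - f y| := by
        rw [← abs_mul]; congr 1; ring
      rw [h1, ← sq_abs (f x + f y), ← sq_abs (f x - f y)]
      nlinarith [sq_nonneg (|f x - f y| * t - |f x + f y|)]
    · simp only [α, γ, δ, h, if_false]
      nlinarith [mul_nonneg (add_nonneg (sq_nonneg (f x)) (sq_nonneg (f y))) (sq_nonneg (t - 1))]
  have h0 : 0 ≤ 2 * (1 - G.dualCheeger) * F :=
    mul_nonneg (mul_nonneg zero_le_two (sub_nonneg.2 G.dualCheeger_le_one)) hpos.le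
  have hsq : (2 * (1 - G.dualCheeger) * F) ^ 2 ≤ α' * γ' := by
    refine (pow_le_pow_left₀ h0 hδ 2).trans ?_
    rw [discrim] at hdisc
    linarith
  refine ⟨α' / (2 * F), ?_, ?_⟩
  · rw [div_le_iff₀ (by positivity)]
    linarith
  · have hγ : γ' = 4 * F - α' := by linarith
    have : α' / (2 * F) * (2 - α' / (2 * F)) = α' * γ' / (2 * F) ^ 2 := by
      rw [hγ]
      field_simp
      ring
    rw [this, le_div_iff₀ (by positivity)]
    linarith

end Cheeger

end OFGraph

theorem theorem2 {V K : Type*} [Fintype V] [DecidableEq V] [Nontrivial V]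
    [Field K] [LinearOrder K] [IsStrictOrderedRing K] [IsRealClosed K]
    (G : OFGraph V K) (hG : ∀ x, ¬ G.IsIsolated x) :
    ∃ lam : K, IsGreatest {μ : K | G.laplacian.HasEigenvalue μ} lam ∧
      2 * G.dualCheeger ≤ lam ∧
      ∃ s : K, 0 ≤ s ∧ s ^ 2 = 1 - (1 - G.dualCheeger) ^ 2 ∧ lam ≤ 1 + s := by
  obtain ⟨lam, hgreatest, hrayleigh⟩ :=
    G.form.exists_isGreatest_hasEigenvalue (G.form_self_pos hG) (G.form_laplacian_left hG)
  refine ⟨lam, hgreatest, G.two_mul_dualCheeger_le hG hrayleigh, ?_⟩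
  have h0 := G.dualCheeger_nonneg
  have h1 := G.dualCheeger_le_one
  obtain ⟨r, hr⟩ := IsSquare.of_nonneg
    (show 0 ≤ 1 - (1 - G.dualCheeger) ^ 2 by nlinarith)
  obtain ⟨a, ha, hsq⟩ := G.sq_one_sub_dualCheeger_le hG hgreatest.1
  refine ⟨|r|, abs_nonneg r, by rw [sq_abs, hr, pow_two], ?_⟩
  -- `(1 - a)² = 1 - a(2 - a) ≤ r²`, while `lam - 1 ≤ 1 - a`.
  have : 1 - a ≤ |r| := by
    refine (le_abs_self _).trans (sq_le_sq.1 ?_)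
    rw [pow_two r, ← hr]
    linarith
  linarith
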